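/- Let $M:\mathbb R\to\mathbb R$ be an Orlicz function, i.e., $M$ is convex and even, $M(0)=0$, and $M(t)>0$ for $t\neq 0$. Let $R\in(0,\infty)$ and, for $d\in\mathbb N$, let \[ B_M^d(dR)=\Big\{x\in\mathbb R^d : \sum_{i=1}^d M(x_i)\le dR\Big\}, \] and let $\mathrm{vol}_d$ denote $d$-dimensional Lebesgue measure. Then for every $\alpha<0$ the integral $\int_{\mathbb R}e^{\alpha M(x)}\,dx$ is finite, the function $\varphi:(-\infty,0)\to\mathbb R$, $\varphi(\alpha)=\log\int_{\mathbb R}e^{\alpha M(x)}\,dx$, is twice continuously differentiable, there is exactly one $\alpha_*<0$ with $\varphi'(\alpha_*)=R$, and $\sigma_*^2:=\varphi''(\alpha_*)>0$. Moreover, as $d\to\infty$, \[ \mathrm{vol}_d\big(B_M^d(dR)\big)^{1/d}\to e^{\varphi(\alpha_*)-\alpha_*R}, \qquad \frac1d\log\mathrm{vol}_d\big(B_M^d(dR)\big)\to\varphi(\alpha_*)-\alpha_*R, \] and \[ \mathrm{vol}_d\big(B_M^d(dR)\big)\sim\frac{1}{|\alpha_*|\sqrt{2\pi d\,\sigma_*^2}}\,e^{d[\varphi(\alpha_*)-\alpha_*R]},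 \] where $a_d\sim b_d$ means $\lim_{d\to\infty}a_d/b_d=1$. -/

import Mathlib

open MeasureTheory Filter Topology

/-- `M : ℝ → ℝ` is an Orlicz function: convex, even, `M 0 = 0`, and `M t > 0` for `t ≠ 0`. -/
structure IsOrliczFunction (M : ℝ → ℝ) : Prop where
  convex : ConvexOn ℝ Set.univ M
  even : ∀ t, M (-t) = M t
  map_zero : M 0 = 0
  pos : ∀ t, t ≠ 0 → 0 < M t

/-- The Orlicz ball `B_M^d(r) = {x ∈ ℝ^d : ∑ i, M (x i) ≤ r}`. -/
def orliczBall (M : ℝ → ℝ) (d : ℕ) (r : ℝ) : Set (Fin d → ℝ) :=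
  {x | ∑ i, M (x i) ≤ r}

/-- `vol_d (B_M^d(dR))`, the `d`-dimensional Lebesgue measure of the Orlicz ball of radius `d * R`. -/
noncomputable def orliczVol (M : ℝ → ℝ) (R : ℝ) (d : ℕ) : ℝ :=
  (volume (orliczBall M d (d * R))).toReal

/-- `φ(α) = log ∫ e^{α M(x)} dx`, used for `α < 0`. -/
noncomputable def orliczPhi (M : ℝ → ℝ) (α : ℝ) : ℝ :=
  Real.log (∫ x, Real.exp (α * M x))

/-! The proof combines exponential tilting with a local limit theorem. On `(-∞, 0)`, `φ` is the
cumulant generating function of `M` under Lebesgue measure, so it is analytic, and `φ'`, `φ''` are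
the mean and variance of `M` under the tilted law with density `e^{αM - φ(α)}`. Since `M` is not
constant, `φ'' > 0`, which makes `α_*` unique. It exists because `φ(α) - αR` has an interior
minimum.

At `α = α_*` the sum `S = ∑ (M(x_i) - R)` is centred under the product of tilted laws, and the
volume equals `e^{d[φ(α) - αR]} E[e^{-αS}; S ≤ 0]` (`orliczVol_eq`). It remains to show `√d E[h(S)]
→ ∫ h / √(2πσ_*²)` for `h(y) = e^{-αy} 1_{y ≤ 0}`, whose integral is `1/|α|`. If `h` is continuous
and integrable with integrable Fourier transform, inversion turns `E[h(S)]` into `∫ ĥ χ^d`, with `χ`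
the rescaled characteristic function of `M - R`. Near `0`, `χ^d` becomes Gaussian after scaling by
`√d`. Away from `0`, `|χ| ≤ ρ < 1` because the law of `M - R` is absolutely continuous
(`exists_norm_charFun_le`). The actual `h` jumps at `0`, so it is squeezed between `oneSidedExpSub`
and `twoSidedExp`, whose integrals differ from `1/|α|` by `1/n`. The root and logarithmic limits
follow from the sharp one. -/

section

open ProbabilityTheory Set
open scoped FourierTransform

/-! ### Growth of Orlicz functions -/

namespace IsOrliczFunction

variable {M : ℝ → ℝ}

lemma continuous (hM : IsOrliczFunction M) : Continuous M := by
  rw [← continuousOn_univ]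
  exact hM.convex.continuousOn isOpen_univ

/-- Chord slopes of a convex function increase: the chord over `[x, y]` is at least as steep as the
one over `[0, x]`, hence as the one over `[0, a]`. -/
lemma div_le_slope (hM : IsOrliczFunction M) {a x y : ℝ} (ha : 0 < a) (hx : a ≤ x) (hxy : x < y) :
    M a / a * (y - x) ≤ M y - M x := by
  have h1 := hM.convex.secant_mono (mem_univ 0) (mem_univ a) (mem_univ x) ha.ne'
    (ha.trans_le hx).ne' hx
  have h2 := hM.convex.slope_mono_adjacent (mem_univ 0) (mem_univ y) (ha.trans_le hx) hxy
  simp only [hM.map_zero, sub_zero] at h1 h2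
  rw [← le_div_iff₀ (sub_pos.2 hxy)]
  exact h1.trans h2

lemma monotoneOn (hM : IsOrliczFunction M) {x y : ℝ} (hx : 0 ≤ x) (hxy : x ≤ y) : M x ≤ M y := by
  rcases hxy.eq_or_lt with rfl | hlt
  · rfl
  rcases hx.eq_or_lt with rfl | hx0
  · rw [hM.map_zero]; exact (hM.pos y hlt.ne').le
  have := hM.div_le_slope hx0 le_rfl hlt
  have h2 : 0 ≤ M x / x * (y - x) :=
    mul_nonneg (div_nonneg (hM.pos x hx0.ne').le hx) (sub_nonneg.2 hxy)
  linarith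

lemma map_abs (hM : IsOrliczFunction M) (x : ℝ) : M |x| = M x := by
  rcases abs_cases x with h | h
  · rw [h.1]
  · rw [h.1, hM.even]

lemma linear_lower_bound (hM : IsOrliczFunction M) (x : ℝ) : M 1 * (|x| - 1) ≤ M x := by
  rw [← hM.map_abs x]
  rcases lt_or_ge 1 |x| with h | h
  · have := hM.div_le_slope one_pos le_rfl h
    have h1 := hM.pos 1 one_ne_zero
    rw [div_one] at this
    linarith
  · have h1 := hM.pos 1 one_ne_zero
    have : 0 ≤ M |x| := by
      rw [← hM.map_zero]; exact hM.monotoneOn le_rfl (abs_nonneg x)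
    nlinarith

end IsOrliczFunction

lemma integrable_exp_mul_abs_real {b : ℝ} (hb : b < 0) :
    Integrable (fun x : ℝ => Real.exp (b * |x|)) := by
  rw [← integrableOn_univ, ← Iic_union_Ioi (a := (0 : ℝ))]
  refine IntegrableOn.union ?_ ?_
  · refine (integrableOn_exp_mul_Iic (neg_pos.2 hb) 0).congr_fun (fun x hx => ?_) measurableSet_Iic
    simp only [mem_Iic] at hx
    simp [abs_of_nonpos hx]
  · refine (integrableOn_exp_mul_Ioi hb 0).congr_fun (fun x hx => ?_) measurableSet_Ioi
    simp only [mem_Ioi] at hx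
    simp [abs_of_pos hx]

/-- A function that expands distances on `s` pulls null sets back to null subsets of `s`. -/
lemma volume_preimage_inter_eq_zero {f : ℝ → ℝ} {s N : Set ℝ} {c : ℝ} (hc : 0 < c)
    (hf : ∀ x ∈ s, ∀ y ∈ s, c * |x - y| ≤ |f x - f y|) (hN : volume N = 0) :
    volume (s ∩ f ⁻¹' N) = 0 := by
  have hinj : InjOn f s := fun x hx y hy hxy => by
    have := hf x hx y hy
    rw [hxy, sub_self, abs_zero] at this
    have h2 : |x - y| ≤ 0 := by
      by_contra h
      push Not at h
      nlinarith
    exact sub_eq_zero.1 (abs_nonpos_iff.1 h2)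
  have hg : LipschitzOnWith (Real.toNNReal c⁻¹) (Function.invFunOn f s) (f '' s) := by
    refine LipschitzOnWith.of_dist_le_mul ?_
    rintro _ ⟨x, hx, rfl⟩ _ ⟨y, hy, rfl⟩
    rw [hinj.leftInvOn_invFunOn hx, hinj.leftInvOn_invFunOn hy, Real.dist_eq, Real.dist_eq,
      Real.coe_toNNReal _ (inv_pos.2 hc).le, ← div_eq_inv_mul, le_div_iff₀ hc, mul_comm]
    exact hf x hx y hy
  have hT : s ∩ f ⁻¹' N = Function.invFunOn f s '' (f '' (s ∩ f ⁻¹' N)) := by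
    rw [hinj.leftInvOn_invFunOn.image_image' inter_subset_left]
  -- Lebesgue measure is one-dimensional Hausdorff measure, so the Lipschitz inverse of `f` maps
  -- null sets to null sets.
  rw [← hausdorffMeasure_real] at hN ⊢
  have h := (hg.mono (image_mono (inter_subset_left (t := f ⁻¹' N)))).hausdorffMeasure_image_le
    zero_le_one
  rw [← hT] at h
  refine le_antisymm (h.trans ?_) zero_le
  rw [measure_mono_null (by rintro _ ⟨x, hx, rfl⟩; exact hx.2) hN, mul_zero]

/-! ### The cumulant generating function and the tilted law -/

namespace IsOrliczFunction

variable {M : ℝ → ℝ}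

lemma integrable_exp (hM : IsOrliczFunction M) {α : ℝ} (hα : α < 0) :
    Integrable (fun x : ℝ => Real.exp (α * M x)) := by
  have h1 := hM.pos 1 one_ne_zero
  refine ((integrable_exp_mul_abs_real (mul_neg_of_neg_of_pos hα h1)).const_mul
    (Real.exp (-(α * M 1)))).mono' ?_ (ae_of_all _ fun x => ?_)
  · exact (Real.continuous_exp.comp (continuous_const.mul hM.continuous)).aestronglyMeasurable
  · rw [Real.norm_of_nonneg (Real.exp_pos _).le, ← Real.exp_add]
    refine Real.exp_le_exp.2 ?_
    nlinarith [hM.linear_lower_bound x]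

lemma mem_interior_integrableExpSet (hM : IsOrliczFunction M) {α : ℝ} (hα : α < 0) :
    α ∈ interior (integrableExpSet M volume) :=
  interior_maximal (t := Iio 0) (fun _ hx => hM.integrable_exp hx) isOpen_Iio hα

lemma orliczPhi_eq_cgf (M : ℝ → ℝ) : orliczPhi M = cgf M volume := rfl

lemma analyticOnNhd_orliczPhi (hM : IsOrliczFunction M) :
    AnalyticOnNhd ℝ (orliczPhi M) (Iio 0) :=
  fun _ hα => analyticAt_cgf (hM.mem_interior_integrableExpSet hα)

/-- Away from the origin `M` expands distances by `div_le_slope`, on each half-line separately; only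
the null set `{0}` is left out. This is the source of Cramér's condition. -/
lemma map_volume_absolutelyContinuous (hM : IsOrliczFunction M) (R : ℝ) :
    volume.map (fun x => M x - R) ≪ volume := by
  refine Measure.AbsolutelyContinuous.mk fun N hNm hN => ?_
  have hf : Continuous fun x => M x - R := hM.continuous.sub continuous_const
  rw [Measure.map_apply hf.measurable hNm]
  have hexp : ∀ a : ℝ, 0 < a → ∀ x y : ℝ, a ≤ x → a ≤ y → M a / a * |x - y| ≤ |M x - M y| := by
    intro a ha x y hx hy
    rcases lt_trichotomy x y with h | h | h
    · rw [abs_sub_comm x, abs_sub_comm (M x), abs_of_pos (sub_pos.2 h)]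
      exact (hM.div_le_slope ha hx h).trans (le_abs_self _)
    · simp [h]
    · rw [abs_of_pos (sub_pos.2 h)]
      exact (hM.div_le_slope ha hy h).trans (le_abs_self _)
  have hpos : ∀ n : ℕ, (0 : ℝ) < 1 / (n + 1) := fun n => Nat.one_div_pos_of_nat
  have h1 : ∀ n : ℕ, volume (Ici (1 / ((n : ℝ) + 1)) ∩ (fun x => M x - R) ⁻¹' N) = 0 := by
    intro n
    refine volume_preimage_inter_eq_zero (div_pos (hM.pos _ (hpos n).ne') (hpos n))
      (fun x hx y hy => ?_) hN
    rw [sub_sub_sub_cancel_right]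
    exact hexp _ (hpos n) x y hx hy
  have h2 : ∀ n : ℕ, volume (Iic (-(1 / ((n : ℝ) + 1))) ∩ (fun x => M x - R) ⁻¹' N) = 0 := by
    intro n
    refine volume_preimage_inter_eq_zero (div_pos (hM.pos _ (hpos n).ne') (hpos n))
      (fun x hx y hy => ?_) hN
    rw [sub_sub_sub_cancel_right, ← hM.even x, ← hM.even y, abs_sub_comm,
      show y - x = -x - -y by ring]
    exact hexp _ (hpos n) (-x) (-y) (le_neg.2 hx) (le_neg.2 hy)
  refine measure_mono_null (t := {0} ∪ ⋃ n : ℕ,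
    ((Ici (1 / ((n : ℝ) + 1)) ∩ (fun x => M x - R) ⁻¹' N) ∪
      (Iic (-(1 / ((n : ℝ) + 1))) ∩ (fun x => M x - R) ⁻¹' N))) (fun x hx => ?_) ?_
  · rcases eq_or_ne x 0 with rfl | h0
    · simp
    · obtain ⟨n, hn⟩ := exists_nat_one_div_lt (abs_pos.2 h0)
      refine Or.inr (mem_iUnion.2 ⟨n, ?_⟩)
      rcases lt_abs.1 hn with h | h
      · exact Or.inl ⟨h.le, hx⟩
      · exact Or.inr ⟨by rw [mem_Iic]; linarith, hx⟩
  · refine measure_union_null (by simp) (measure_iUnion_null fun n => measure_union_null (h1 n) (h2 n))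

lemma tilted_isProbabilityMeasure (hM : IsOrliczFunction M) {α : ℝ} (hα : α < 0) :
    IsProbabilityMeasure (volume.tilted (α * M ·)) :=
  isProbabilityMeasure_tilted (hM.integrable_exp hα)

lemma deriv_deriv_orliczPhi (hM : IsOrliczFunction M) {α : ℝ} (hα : α < 0) :
    deriv (deriv (orliczPhi M)) α = Var[M; volume.tilted (α * M ·)] := by
  rw [variance_tilted_mul (hM.mem_interior_integrableExpSet hα), iteratedDeriv_succ,
    iteratedDeriv_one, orliczPhi_eq_cgf]

/-- Zero variance would make `M` constant almost everywhere, hence everywhere by continuity, against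
`M 0 = 0 < M 1`. -/
lemma deriv_deriv_orliczPhi_pos (hM : IsOrliczFunction M) {α : ℝ} (hα : α < 0) :
    0 < deriv (deriv (orliczPhi M)) α := by
  rw [hM.deriv_deriv_orliczPhi hα]
  have := hM.tilted_isProbabilityMeasure hα
  refine lt_of_le_of_ne (variance_nonneg _ _) fun h => ?_
  have hLp : MemLp M 2 (volume.tilted (α * M ·)) :=
    memLp_tilted_mul (hM.mem_interior_integrableExpSet hα) 2
  have hev : evariance M (volume.tilted (α * M ·)) = 0 := by
    rw [← hLp.ofReal_variance_eq, ← h, ENNReal.ofReal_zero]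
  have hae := (evariance_eq_zero_iff hLp.aestronglyMeasurable.aemeasurable).1 hev
  set m := ∫ x, M x ∂(volume.tilted (α * M ·))
  have hae' : M =ᵐ[volume] fun _ => m :=
    (absolutelyContinuous_tilted (hM.integrable_exp hα)).ae_eq hae
  have heq := Continuous.ae_eq_iff_eq volume hM.continuous continuous_const |>.1 hae'
  have h0 := congrFun heq 0
  have h1 := congrFun heq 1
  have := hM.pos 1 one_ne_zero
  rw [hM.map_zero] at h0
  linarith

lemma strictMonoOn_deriv_orliczPhi (hM : IsOrliczFunction M) :
    StrictMonoOn (deriv (orliczPhi M)) (Iio 0) := by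
  refine strictMonoOn_of_deriv_pos (convex_Iio 0) ?_ fun x hx => ?_
  · exact fun x hx => (hM.analyticOnNhd_orliczPhi.deriv x hx).continuousAt.continuousWithinAt
  · rw [interior_Iio] at hx
    exact hM.deriv_deriv_orliczPhi_pos hx

lemma le_orliczPhi (hM : IsOrliczFunction M) {α T : ℝ} (hα : α < 0) (hT : 0 < T) :
    Real.log T + α * M T ≤ orliczPhi M α := by
  rw [orliczPhi, Real.le_log_iff_exp_le (integral_exp_pos (hM.integrable_exp hα)), Real.exp_add,
    Real.exp_log hT]
  calc T * Real.exp (α * M T) = ∫ x in Icc 0 T, Real.exp (α * M T) := by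
        simp [hT.le]
    _ ≤ ∫ x in Icc 0 T, Real.exp (α * M x) := by
        refine setIntegral_mono_on (by simp) (hM.integrable_exp hα).integrableOn
          measurableSet_Icc fun x hx => Real.exp_le_exp.2 ?_
        exact mul_le_mul_of_nonpos_left (hM.monotoneOn hx.1 hx.2) hα.le
    _ ≤ ∫ x, Real.exp (α * M x) :=
        setIntegral_le_integral (hM.integrable_exp hα) (ae_of_all _ fun x => (Real.exp_pos _).le)

/-- `R` is the derivative of `φ` at an interior minimum of `ψ(α) = φ(α) - αR`. Such a minimum exists
because `le_orliczPhi` lifts `ψ` above `ψ(-1)` at both ends: large `T` serves near `0`, small `T`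
near `-∞`. -/
lemma exists_deriv_orliczPhi_eq (hM : IsOrliczFunction M) {R : ℝ} (hR : 0 < R) :
    ∃ α : ℝ, α < 0 ∧ deriv (orliczPhi M) α = R := by
  set ψ : ℝ → ℝ := fun α => orliczPhi M α - α * R with hψ
  have hdiff : ∀ α < 0, HasDerivAt ψ (deriv (orliczPhi M) α - R) α := fun α hα => by
    have h := (hM.analyticOnNhd_orliczPhi α hα).differentiableAt.hasDerivAt
    exact (h.sub ((hasDerivAt_id α).mul_const R)).congr_deriv (by simp)
  set C := ψ (-1)
  obtain ⟨b, hb0, hb1, hb⟩ : ∃ b : ℝ, b < 0 ∧ -1 < b ∧ ∀ α, b ≤ α → α < 0 → C < ψ α := by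
    set T := Real.exp (C + 1)
    have hT : 0 < T := Real.exp_pos _
    have hMT := hM.pos T hT.ne'
    refine ⟨-min (1 / 2) (1 / (2 * M T)), by simp [hMT], ?_, fun α hα h0 => ?_⟩
    · have := min_le_left (1 / 2 : ℝ) (1 / (2 * M T)); linarith
    · have h1 := hM.le_orliczPhi h0 hT
      rw [Real.log_exp] at h1
      have h2 : -α ≤ 1 / (2 * M T) := (neg_le.1 hα).trans (min_le_right _ _)
      have h3 : -α * M T ≤ 1 / 2 := by
        calc -α * M T ≤ 1 / (2 * M T) * M T := mul_le_mul_of_nonneg_right h2 hMT.le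
          _ = 1 / 2 := by field_simp
      have h4 : 0 ≤ -α * R := mul_nonneg (neg_nonneg.2 h0.le) hR.le
      simp only [hψ]
      linarith
  obtain ⟨a, ha1, ha⟩ : ∃ a : ℝ, a < -1 ∧ ∀ α, α ≤ a → C < ψ α := by
    obtain ⟨T, hT, hTR⟩ : ∃ T : ℝ, 0 < T ∧ M T ≤ R / 2 := by
      have h := hM.continuous.tendsto 0
      rw [hM.map_zero] at h
      have h2 := (h.eventually (ge_mem_nhds (half_pos hR))).filter_mono
        (nhdsWithin_le_nhds (s := Ioi (0 : ℝ)))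
      obtain ⟨T, h3, h4⟩ := (h2.and self_mem_nhdsWithin).exists
      exact ⟨T, h4, h3⟩
    -- As `M T ≤ R / 2`, `ψ α ≥ log T - αR/2`; this choice makes `-αR/2` at least `R + |C - log T|`.
    refine ⟨-(2 + 2 * |C - Real.log T| / R), ?_, fun α hα => ?_⟩
    · have : 0 ≤ 2 * |C - Real.log T| / R := by positivity
      linarith
    · have hpos : 0 ≤ 2 * |C - Real.log T| / R := by positivity
      have h0 : α < 0 := by linarith
      have h1 := hM.le_orliczPhi h0 hT
      have h2 : (2 * |C - Real.log T| / R) * R = 2 * |C - Real.log T| := by field_simp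
      have h3 := le_abs_self (C - Real.log T)
      simp only [hψ]
      nlinarith
  obtain ⟨α, hα, hmin⟩ := isCompact_Icc.exists_isMinOn (s := Icc a b) (f := ψ)
    ⟨-1, ha1.le, hb1.le⟩ fun x hx => (hdiff x (hx.2.trans_lt hb0)).continuousAt.continuousWithinAt
  have hle : ψ α ≤ C := hmin ⟨ha1.le, hb1.le⟩
  have hαa : a < α := lt_of_le_of_ne hα.1 fun h => (ha α h.ge).not_ge hle
  have hα0 : α < 0 := hα.2.trans_lt hb0
  have hαb : α < b := lt_of_le_of_ne hα.2 fun h => (hb α h.ge hα0).not_ge hle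
  refine ⟨α, hα0, ?_⟩
  have := (hmin.isLocalMin (Icc_mem_nhds hαa hαb)).hasDerivAt_eq_zero (hdiff α hα0)
  linarith

end IsOrliczFunction

/-! ### Laplace asymptotics of powers -/

/-- Powers of a function with a second order expansion at `0` converge to a Gaussian. -/
lemma tendsto_pow_of_isLittleO_sq {χ : ℝ → ℂ} {v : ℝ}
    (hχ : (fun t : ℝ => χ t - (1 - v * t ^ 2 / 2)) =o[𝓝 0] fun t : ℝ => t ^ 2) (u : ℝ) :
    Tendsto (fun d : ℕ => χ (u / √d) ^ d) atTop (𝓝 (Complex.exp (-(v * u ^ 2 / 2) : ℂ))) := by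
  refine Complex.tendsto_pow_exp_of_isLittleO_sub_add_div _ ?_
  have hlim : Tendsto (fun d : ℕ => u / √d) atTop (𝓝 0) :=
    tendsto_const_nhds.div_atTop (Real.tendsto_sqrt_atTop.comp tendsto_natCast_atTop_atTop)
  have h := hχ.comp_tendsto hlim
  have hO : ((fun t : ℝ => t ^ 2) ∘ fun d : ℕ => u / √d) =O[atTop] fun d : ℕ => 1 / (d : ℂ) := by
    refine Asymptotics.IsBigO.of_bound (u ^ 2) (Eventually.of_forall fun d => ?_)
    simp only [Function.comp, div_pow, Real.sq_sqrt (Nat.cast_nonneg d), norm_div, norm_one,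
      Complex.norm_natCast, norm_pow, Real.norm_eq_abs, sq_abs, Nat.abs_cast]
    exact le_of_eq (by ring)
  refine (h.trans_isBigO hO).congr_left fun d => ?_
  simp only [Function.comp]
  rw [← Complex.ofReal_pow, div_pow, Real.sq_sqrt (Nat.cast_nonneg d)]
  push_cast
  ring

/-- Allowing a Taylor error of half the quadratic term leaves `1 - v t² / 4`. The Gaussian bound is
the majorant for dominated convergence. -/
lemma exists_norm_le_exp_of_isLittleO_sq {χ : ℝ → ℂ} {v : ℝ} (hv : 0 < v)
    (hχ : (fun t : ℝ => χ t - (1 - v * t ^ 2 / 2)) =o[𝓝 0] fun t : ℝ => t ^ 2) :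
    ∀ᶠ t : ℝ in 𝓝 0, ‖χ t‖ ≤ Real.exp (-(v / 4) * t ^ 2) := by
  have h1 := hχ.def (show 0 < v / 4 by positivity)
  have h2 : ∀ᶠ t : ℝ in 𝓝 0, v * t ^ 2 / 2 < 1 := by
    have : ContinuousAt (fun t : ℝ => v * t ^ 2 / 2) 0 := by fun_prop
    refine this.eventually (gt_mem_nhds ?_)
    simp
  filter_upwards [h1, h2] with t ht1 ht2
  have h3 : ‖(1 - v * t ^ 2 / 2 : ℂ)‖ = 1 - v * t ^ 2 / 2 := by
    rw [show (1 - v * t ^ 2 / 2 : ℂ) = ((1 - v * t ^ 2 / 2 : ℝ) : ℂ) by push_cast; rfl,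
      Complex.norm_real, Real.norm_of_nonneg (by linarith)]
  have h4 : ∀ z : ℂ, ‖χ t‖ ≤ ‖χ t - z‖ + ‖z‖ := fun z => by
    simpa using norm_add_le (χ t - z) z
  have h4 := h4 (1 - v * t ^ 2 / 2)
  rw [Real.norm_of_nonneg (sq_nonneg t)] at ht1
  have h5 := Real.add_one_le_exp (-(v / 4) * t ^ 2)
  linarith

lemma tendsto_sqrt_mul_pow_zero {ρ : ℝ} (h0 : 0 ≤ ρ) (h1 : ρ < 1) :
    Tendsto (fun d : ℕ => √d * ρ ^ d) atTop (𝓝 0) := by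
  refine squeeze_zero (fun d => by positivity) (fun d => ?_)
    (tendsto_self_mul_const_pow_of_lt_one h0 h1)
  refine mul_le_mul_of_nonneg_right ?_ (pow_nonneg h0 d)
  rcases Nat.eq_zero_or_pos d with rfl | hd
  · simp
  · have : (1 : ℝ) ≤ d := by exact_mod_cast hd
    rw [Real.sqrt_le_left (by positivity)]
    nlinarith

/-- Laplace-type asymptotics of `∫ H χ ^ d` for a function `χ` that has a second order expansion
at `0` and is bounded away from `1` in modulus away from `0`. -/
theorem tendsto_sqrt_mul_integral_mul_pow {χ H : ℝ → ℂ} {v : ℝ} (hv : 0 < v)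
    (hχc : Continuous χ) (hχ1 : ∀ t, ‖χ t‖ ≤ 1)
    (hχ : (fun t : ℝ => χ t - (1 - v * t ^ 2 / 2)) =o[𝓝 0] fun t : ℝ => t ^ 2)
    (hCr : ∀ ε > 0, ∃ ρ < 1, ∀ t : ℝ, ε ≤ |t| → ‖χ t‖ ≤ ρ)
    (hH : Integrable H) (hHc : ContinuousAt H 0) :
    Tendsto (fun d : ℕ => (√d : ℂ) * ∫ t, H t * χ t ^ d) atTop (𝓝 (H 0 * √(2 * Real.pi / v))) := by
  obtain ⟨ε, hε, hball⟩ : ∃ ε > 0, ∀ t : ℝ, |t| < ε →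
      ‖χ t‖ ≤ Real.exp (-(v / 4) * t ^ 2) ∧ ‖H t‖ ≤ ‖H 0‖ + 1 := by
    have hH1 : ∀ᶠ t : ℝ in 𝓝 0, ‖H t‖ ≤ ‖H 0‖ + 1 :=
      hHc.norm.eventually (ge_mem_nhds (lt_add_one _))
    obtain ⟨ε, hε, h⟩ := Metric.eventually_nhds_iff.1
      ((exists_norm_le_exp_of_isLittleO_sq hv hχ).and hH1)
    exact ⟨ε, hε, fun t ht => h (by simpa [Real.dist_eq] using ht)⟩
  obtain ⟨ρ', hρ'1, hρ'⟩ := hCr ε hε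
  set ρ := max ρ' 0
  have hρ0 : 0 ≤ ρ := le_max_right _ _
  have hρ1 : ρ < 1 := max_lt hρ'1 one_pos
  have hρ : ∀ t : ℝ, ε ≤ |t| → ‖χ t‖ ≤ ρ := fun t ht => (hρ' t ht).trans (le_max_left _ _)
  set s : Set ℝ := {t | |t| < ε}
  have hs : MeasurableSet s := measurableSet_lt measurable_abs measurable_const
  have hint : ∀ d : ℕ, Integrable fun t => H t * χ t ^ d := fun d => by
    refine hH.mono (hH.aestronglyMeasurable.mul (hχc.pow d).aestronglyMeasurable)
      (ae_of_all _ fun t => ?_)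
    rw [norm_mul, norm_pow]
    exact mul_le_of_le_one_right (norm_nonneg _) (pow_le_one₀ (norm_nonneg _) (hχ1 t))
  have htail : Tendsto (fun d : ℕ => (√d : ℂ) * ∫ t in sᶜ, H t * χ t ^ d) atTop (𝓝 0) := by
    have hz : Tendsto (fun d : ℕ => (√d * ρ ^ d) * ∫ t, ‖H t‖) atTop (𝓝 0) := by
      simpa using (tendsto_sqrt_mul_pow_zero hρ0 hρ1).mul_const (∫ t, ‖H t‖)
    refine squeeze_zero_norm (fun d => ?_) hz
    rw [norm_mul, Complex.norm_real, Real.norm_of_nonneg (Real.sqrt_nonneg _), mul_assoc]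
    refine mul_le_mul_of_nonneg_left ?_ (Real.sqrt_nonneg _)
    calc ‖∫ t in sᶜ, H t * χ t ^ d‖ ≤ ∫ t in sᶜ, ρ ^ d * ‖H t‖ := by
          refine norm_integral_le_of_norm_le (hH.norm.const_mul _).integrableOn ?_
          refine (ae_restrict_iff' hs.compl).2 (ae_of_all _ fun t ht => ?_)
          rw [norm_mul, norm_pow, mul_comm]
          exact mul_le_mul_of_nonneg_right
            (pow_le_pow_left₀ (norm_nonneg _) (hρ t (not_lt.1 ht)) d) (norm_nonneg _)
      _ ≤ ∫ t, ρ ^ d * ‖H t‖ := setIntegral_le_integral (hH.norm.const_mul _)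
          (ae_of_all _ fun t => mul_nonneg (pow_nonneg hρ0 d) (norm_nonneg _))
      _ = ρ ^ d * ∫ t, ‖H t‖ := integral_const_mul _ _
  have hmain : Tendsto (fun d : ℕ => (√d : ℂ) * ∫ t in s, H t * χ t ^ d) atTop
      (𝓝 (H 0 * √(2 * Real.pi / v))) := by
    -- The substitution `t = u / √d` absorbs the factor `√d`.
    have hdct : Tendsto
        (fun d : ℕ => ∫ u : ℝ, s.indicator (fun t => H t * χ t ^ d) (u / √d)) atTop
        (𝓝 (∫ u : ℝ, H 0 * Complex.exp (-(v * u ^ 2 / 2) : ℂ))) := by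
      have hgauss : Integrable fun u : ℝ => (‖H 0‖ + 1) * Real.exp (-(v / 4) * u ^ 2) :=
        (integrable_exp_neg_mul_sq (by positivity)).const_mul _
      refine tendsto_integral_filter_of_dominated_convergence _ ?_ ?_ hgauss ?_
      · filter_upwards [eventually_gt_atTop 0] with d hd
        have : (√d)⁻¹ ≠ 0 := inv_ne_zero (Real.sqrt_ne_zero'.2 (Nat.cast_pos.2 hd))
        simp_rw [div_eq_mul_inv]
        exact (((hint d).indicator hs).comp_mul_right' this).aestronglyMeasurable
      · filter_upwards [eventually_gt_atTop 0] with d hd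
        refine ae_of_all _ fun u => ?_
        by_cases hu : u / √d ∈ s
        · rw [indicator_of_mem hu, norm_mul, norm_pow]
          obtain ⟨h1, h2⟩ := hball _ hu
          refine mul_le_mul h2 ?_ (by positivity) (by positivity)
          refine (pow_le_pow_left₀ (norm_nonneg _) h1 d).trans_eq ?_
          rw [← Real.exp_nat_mul, div_pow, Real.sq_sqrt (Nat.cast_nonneg d)]
          have : (d : ℝ) ≠ 0 := (Nat.cast_pos.2 hd).ne'
          congr 1
          field_simp
        · rw [indicator_of_notMem hu, norm_zero]
          positivity
      · refine ae_of_all _ fun u => ?_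
        have hlim : Tendsto (fun d : ℕ => u / √d) atTop (𝓝 0) :=
          tendsto_const_nhds.div_atTop (Real.tendsto_sqrt_atTop.comp tendsto_natCast_atTop_atTop)
        have hmem : ∀ᶠ d : ℕ in atTop, u / √d ∈ s := by
          refine hlim.eventually ?_
          exact (continuous_abs.isOpen_preimage _ isOpen_Iio).mem_nhds (by simpa using hε)
        refine ((hHc.tendsto.comp hlim).mul (tendsto_pow_of_isLittleO_sq hχ u)).congr' ?_
        filter_upwards [hmem] with d hd
        rw [indicator_of_mem hd]
        rfl
    have hval : ∫ u : ℝ, H 0 * Complex.exp (-(v * u ^ 2 / 2) : ℂ) = H 0 * √(2 * Real.pi / v) := by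
      rw [integral_const_mul]
      congr 1
      have h := integral_gaussian (v / 2)
      rw [show Real.pi / (v / 2) = 2 * Real.pi / v by field_simp] at h
      rw [← h, ← integral_complex_ofReal]
      congr 1 with u
      push_cast
      congr 1
      ring
    rw [hval] at hdct
    refine hdct.congr fun d => ?_
    have := Measure.integral_comp_div (s.indicator fun t => H t * χ t ^ d) (√d)
    rw [this, integral_indicator hs, abs_of_nonneg (Real.sqrt_nonneg _), Complex.real_smul]
  have hsum := hmain.add htail
  rw [add_zero] at hsum
  refine hsum.congr fun d => ?_
  rw [← mul_add, integral_add_compl hs (hint d)]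

/-! ### Cramér's condition -/

lemma tendsto_charFun_cocompact {ν : Measure ℝ} [IsProbabilityMeasure ν] (hν : ν ≪ volume) :
    Tendsto (charFun ν) (cocompact ℝ) (𝓝 0) := by
  set f : ℝ → ℂ := fun x => ((ν.rnDeriv volume x).toReal : ℂ)
  have hπ : (-(2 * Real.pi)⁻¹ : ℝ) ≠ 0 := by simp [Real.pi_ne_zero]
  have h := (Real.zero_at_infty_fourier f).comp
    (Homeomorph.mulRight₀ (-(2 * Real.pi)⁻¹ : ℝ) hπ).isClosedEmbedding.tendsto_cocompact
  refine h.congr fun t => ?_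
  simp only [Function.comp, Homeomorph.coe_mulRight₀, Real.fourier_real_eq, charFun_apply_real]
  rw [← integral_rnDeriv_smul hν]
  congr 1 with x
  rw [Circle.smul_def, Real.fourierChar_apply, smul_eq_mul, Complex.real_smul, mul_comm]
  congr 2
  push_cast
  have : (Real.pi : ℂ) ≠ 0 := by exact_mod_cast Real.pi_ne_zero
  field_simp

/-- Equality would force `e^{itx}` to be a.e. a constant `c` of modulus one. Then the characteristic
function at `k t` is `c ^ k`, contradicting Riemann–Lebesgue decay. -/
lemma norm_charFun_lt_one {ν : Measure ℝ} [IsProbabilityMeasure ν] (hν : ν ≪ volume) {t : ℝ}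
    (ht : t ≠ 0) : ‖charFun ν t‖ < 1 := by
  have hone : ∀ s x : ℝ, ‖Complex.exp (s * x * Complex.I)‖ = 1 := fun s x => by
    rw [← Complex.ofReal_mul, Complex.norm_exp_ofReal_mul_I]
  rcases ae_eq_const_or_norm_integral_lt_of_norm_le_const (μ := ν)
    (f := fun x : ℝ => Complex.exp (t * x * Complex.I)) (C := 1)
    (ae_of_all _ fun x => (hone t x).le) with h | h
  · exfalso
    set c : ℂ := ⨍ x : ℝ, Complex.exp (t * x * Complex.I) ∂ν
    have hc : ‖c‖ = 1 := by
      obtain ⟨x, hx⟩ := h.exists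
      rw [← hone t x]
      exact congrArg norm hx.symm
    have hpow : ∀ k : ℕ, charFun ν (k * t) = c ^ k := fun k => by
      rw [charFun_apply_real]
      have : (fun x : ℝ => Complex.exp (((k * t : ℝ) : ℂ) * x * Complex.I)) =ᵐ[ν]
          fun _ => c ^ k := by
        filter_upwards [h] with x hx
        rw [Function.const_apply] at hx
        rw [← hx, ← Complex.exp_nat_mul]
        congr 1
        push_cast
        ring
      rw [integral_congr_ae this]
      simp
    have hlim : Tendsto (fun k : ℕ => (k : ℝ) * t) atTop (cocompact ℝ) := by
      rw [← Metric.cobounded_eq_cocompact, ← tendsto_norm_atTop_iff_cobounded]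
      simp only [norm_mul, Real.norm_natCast]
      exact tendsto_natCast_atTop_atTop.atTop_mul_const (norm_pos_iff.2 ht)
    have h0 := ((tendsto_charFun_cocompact hν).comp hlim).norm
    simp only [Function.comp, hpow, norm_pow, hc, one_pow, norm_zero] at h0
    exact one_ne_zero (tendsto_nhds_unique tendsto_const_nhds h0)
  · rw [charFun_apply_real]
    simpa using h

/-- An absolutely continuous law satisfies Cramér's condition. -/
theorem exists_norm_charFun_le {ν : Measure ℝ} [IsProbabilityMeasure ν] (hν : ν ≪ volume) {ε : ℝ}
    (hε : 0 < ε) : ∃ ρ < 1, ∀ t : ℝ, ε ≤ |t| → ‖charFun ν t‖ ≤ ρ := by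
  have hev : ∀ᶠ t in cocompact ℝ, ‖charFun ν t‖ < 1 / 2 := by
    have := (tendsto_charFun_cocompact hν).norm
    rw [norm_zero] at this
    exact this.eventually (gt_mem_nhds (by norm_num))
  obtain ⟨K, hK, hKsub⟩ := mem_cocompact.1 hev
  have hcl : IsClosed {t : ℝ | ε ≤ |t|} := isClosed_le continuous_const continuous_abs
  rcases (K ∩ {t : ℝ | ε ≤ |t|}).eq_empty_or_nonempty with he | hne
  · refine ⟨1 / 2, by norm_num, fun t ht => ?_⟩
    have : t ∈ Kᶜ := fun htK => (he ▸ (⟨htK, ht⟩ : t ∈ K ∩ {t : ℝ | ε ≤ |t|}) : t ∈ (∅ : Set ℝ))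
    exact (hKsub this).le
  · obtain ⟨t₀, ht₀, hmax⟩ := (hK.inter_right hcl).exists_isMaxOn hne
      (continuous_charFun (μ := ν)).norm.continuousOn
    have ht₀' : t₀ ≠ 0 := by
      rintro rfl
      have := ht₀.2
      simp only [mem_ofPred_eq, abs_zero] at this
      linarith
    refine ⟨max (1 / 2) ‖charFun ν t₀‖, max_lt (by norm_num) (norm_charFun_lt_one hν ht₀'),
      fun t ht => ?_⟩
    by_cases htK : t ∈ K
    · exact (hmax ⟨htK, ht⟩).trans (le_max_right _ _)
    · exact (hKsub htK : ‖charFun ν t‖ < 1 / 2).le.trans (le_max_left _ _)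

/-- Second order expansion at `0` of the characteristic function of a centered variable. -/
lemma charFun_map_sub_isLittleO {Ω : Type*} {mΩ : MeasurableSpace Ω} {P : Measure Ω}
    [IsProbabilityMeasure P] {X : Ω → ℝ} (hX : MemLp X 2 P) (h0 : P[X] = 0) :
    (fun t : ℝ => charFun (P.map X) t - (1 - Var[X; P] * t ^ 2 / 2)) =o[𝓝 0]
      fun t : ℝ => t ^ 2 := by
  have hXm : AEMeasurable X P := hX.aestronglyMeasurable.aemeasurable
  have := Measure.isProbabilityMeasure_map hXm
  have hid : MemLp id 2 (P.map X) :=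
    (memLp_map_measure_iff aestronglyMeasurable_id hXm).2 hX
  have h := taylor_isLittleO_univ (x₀ := 0) (contDiff_charFun (n := 2) (by exact_mod_cast hid))
  refine (h.congr_left fun t => ?_).congr_right fun t => by rw [sub_zero]
  rw [taylorWithinEval_charFun_two_zero hXm hid, variance_of_integral_eq_zero hXm h0, h0]
  simp

/-! ### Test functions and their Fourier transforms -/

lemma ofReal_exp_indicator (s : Set ℝ) (a y : ℝ) :
    ((s.indicator (fun y => Real.exp (a * y)) y : ℝ) : ℂ) =
      s.indicator (fun y : ℝ => Complex.exp ((a : ℂ) * y)) y := by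
  by_cases h : y ∈ s <;> simp [h]

lemma integrable_indicator_exp_Iic {a : ℝ} (ha : 0 < a) :
    Integrable fun y : ℝ => (Iic (0 : ℝ)).indicator (fun y => Real.exp (a * y)) y :=
  (integrable_indicator_iff measurableSet_Iic).2 (integrableOn_exp_mul_Iic ha 0)

lemma integrable_indicator_exp_Ioi {a : ℝ} (ha : a < 0) :
    Integrable fun y : ℝ => (Ioi (0 : ℝ)).indicator (fun y => Real.exp (a * y)) y :=
  (integrable_indicator_iff measurableSet_Ioi).2 (integrableOn_exp_mul_Ioi ha 0)

lemma fourier_indicator_exp_Iic {a : ℝ} (ha : 0 < a) (w : ℝ) :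
    𝓕 (fun y : ℝ => (((Iic (0 : ℝ)).indicator (fun y => Real.exp (a * y)) y : ℝ) : ℂ)) w =
      (a - 2 * Real.pi * w * Complex.I)⁻¹ := by
  rw [Real.fourier_real_eq_integral_exp_smul]
  have hre : 0 < (a - 2 * Real.pi * w * Complex.I : ℂ).re := by simpa using ha
  have h := integral_exp_mul_complex_Iic hre 0
  rw [Complex.ofReal_zero, mul_zero, Complex.exp_zero, one_div] at h
  rw [← h, ← integral_indicator measurableSet_Iic]
  congr 1 with y
  rw [ofReal_exp_indicator]
  by_cases hy : y ∈ Iic (0 : ℝ)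
  · rw [indicator_of_mem hy, indicator_of_mem hy, smul_eq_mul, ← Complex.exp_add]
    congr 1
    push_cast
    ring
  · rw [indicator_of_notMem hy, indicator_of_notMem hy, smul_zero]

lemma fourier_indicator_exp_Ioi {a : ℝ} (ha : a < 0) (w : ℝ) :
    𝓕 (fun y : ℝ => (((Ioi (0 : ℝ)).indicator (fun y => Real.exp (a * y)) y : ℝ) : ℂ)) w =
      -(a - 2 * Real.pi * w * Complex.I)⁻¹ := by
  rw [Real.fourier_real_eq_integral_exp_smul]
  have hre : (a - 2 * Real.pi * w * Complex.I : ℂ).re < 0 := by simpa using ha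
  have h := integral_exp_mul_complex_Ioi hre 0
  rw [Complex.ofReal_zero, mul_zero, Complex.exp_zero, neg_div, one_div] at h
  rw [← h, ← integral_indicator measurableSet_Ioi]
  congr 1 with y
  rw [ofReal_exp_indicator]
  by_cases hy : y ∈ Ioi (0 : ℝ)
  · rw [indicator_of_mem hy, indicator_of_mem hy, smul_eq_mul, ← Complex.exp_add]
    congr 1
    push_cast
    ring
  · rw [indicator_of_notMem hy, indicator_of_notMem hy, smul_zero]

/-- Each term decays only like `1/|w|`, but over a common denominator the difference is `O(1/(1 +
w²))`. -/
lemma integrable_inv_sub_inv {a b : ℝ} (ha : a ≠ 0) (hb : b ≠ 0) :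
    Integrable fun w : ℝ => (a - 2 * Real.pi * w * Complex.I : ℂ)⁻¹ -
      (b - 2 * Real.pi * w * Complex.I : ℂ)⁻¹ := by
  have hne : ∀ c : ℝ, c ≠ 0 → ∀ w : ℝ, (c - 2 * Real.pi * w * Complex.I : ℂ) ≠ 0 :=
    fun c hc w h => hc (by simpa using congrArg Complex.re h)
  have hlow : ∀ c : ℝ, c ≠ 0 → ∀ w : ℝ,
      min |c| 1 * √(1 + w ^ 2) ≤ ‖(c - 2 * Real.pi * w * Complex.I : ℂ)‖ := by
    intro c hc w
    have hm : 0 < min |c| 1 := lt_min (abs_pos.2 hc) one_pos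
    have hm1 : min |c| 1 ≤ 1 := min_le_right _ _
    have hmc : min |c| 1 ^ 2 ≤ c ^ 2 := by
      rw [← sq_abs c]
      exact pow_le_pow_left₀ hm.le (min_le_left _ _) 2
    refine le_of_sq_le_sq ?_ (norm_nonneg _)
    rw [mul_pow, Real.sq_sqrt (by positivity), ← Complex.normSq_eq_norm_sq, Complex.normSq_apply]
    simp only [Complex.sub_re, Complex.ofReal_re, Complex.mul_re, Complex.I_re, Complex.I_im,
      Complex.sub_im, Complex.ofReal_im, Complex.mul_im, Complex.re_ofNat, Complex.im_ofNat]
    have h1 : min |c| 1 ^ 2 ≤ 1 := pow_le_one₀ hm.le hm1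
    have h2 : w ^ 2 ≤ (2 * Real.pi * w) ^ 2 := by
      rw [mul_pow]
      exact le_mul_of_one_le_left (sq_nonneg w) (one_le_pow₀ (by linarith [Real.pi_gt_three]))
    have h3 : min |c| 1 ^ 2 * w ^ 2 ≤ w ^ 2 := mul_le_of_le_one_left (sq_nonneg w) h1
    ring_nf at h2 h3 hmc ⊢
    linarith
  set m := min |a| 1 * min |b| 1
  have hm : 0 < m := mul_pos (lt_min (abs_pos.2 ha) one_pos) (lt_min (abs_pos.2 hb) one_pos)
  refine (integrable_inv_one_add_sq.const_mul (|b - a| / m)).mono' ?_ (ae_of_all _ fun w => ?_)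
  · refine Continuous.aestronglyMeasurable (Continuous.sub ?_ ?_)
    · exact Continuous.inv₀ (by fun_prop) (hne a ha)
    · exact Continuous.inv₀ (by fun_prop) (hne b hb)
  · rw [inv_sub_inv (hne a ha w) (hne b hb w), norm_div, norm_mul, div_mul_eq_mul_div,
      ← div_eq_mul_inv, div_div, sub_sub_sub_cancel_right, ← Complex.ofReal_sub,
      Complex.norm_real, Real.norm_eq_abs]
    refine div_le_div_of_nonneg_left (abs_nonneg _) (by positivity) ?_
    calc (1 + w ^ 2) * m = (min |a| 1 * √(1 + w ^ 2)) * (min |b| 1 * √(1 + w ^ 2)) := by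
          rw [mul_mul_mul_comm, Real.mul_self_sqrt (by positivity), mul_comm]
      _ ≤ _ := mul_le_mul (hlow a ha w) (hlow b hb w) (by positivity) (norm_nonneg _)

/-- The two-sided exponential that equals `exp (a * y)` on the negative and `exp (-(b * y))` on the
positive half-line. -/
noncomputable def twoSidedExp (a b : ℝ) (y : ℝ) : ℝ :=
  (Iic (0 : ℝ)).indicator (fun y => Real.exp (a * y)) y +
    (Ioi (0 : ℝ)).indicator (fun y => Real.exp (-b * y)) y

/-- The difference of the exponentials `exp (a * y)` and `exp (b * y)` on the negative
half-line. -/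
noncomputable def oneSidedExpSub (a b : ℝ) (y : ℝ) : ℝ :=
  (Iic (0 : ℝ)).indicator (fun y => Real.exp (a * y)) y -
    (Iic (0 : ℝ)).indicator (fun y => Real.exp (b * y)) y

lemma integrable_twoSidedExp {a b : ℝ} (ha : 0 < a) (hb : 0 < b) : Integrable (twoSidedExp a b) :=
  (integrable_indicator_exp_Iic ha).add (integrable_indicator_exp_Ioi (neg_lt_zero.2 hb))

lemma integrable_oneSidedExpSub {a b : ℝ} (ha : 0 < a) (hb : 0 < b) :
    Integrable (oneSidedExpSub a b) :=
  (integrable_indicator_exp_Iic ha).sub (integrable_indicator_exp_Iic hb)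

lemma continuous_twoSidedExp (a b : ℝ) : Continuous (twoSidedExp a b) := by
  have : twoSidedExp a b = fun y => if y ≤ 0 then Real.exp (a * y) else Real.exp (-b * y) := by
    ext y
    rcases le_or_gt y 0 with h | h
    · simp [twoSidedExp, h, h.not_gt]
    · simp [twoSidedExp, h, h.not_ge]
  rw [this]
  exact Continuous.if_le (by fun_prop) (by fun_prop) continuous_id continuous_const
    fun y hy => by simp [show y = 0 from hy]

lemma continuous_oneSidedExpSub (a b : ℝ) : Continuous (oneSidedExpSub a b) := by
  have : oneSidedExpSub a b =
      fun y => if y ≤ 0 then Real.exp (a * y) - Real.exp (b * y) else 0 := by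
    ext y
    rcases le_or_gt y 0 with h | h
    · simp [oneSidedExpSub, h]
    · simp [oneSidedExpSub, h.not_ge]
  rw [this]
  exact Continuous.if_le (by fun_prop) (by fun_prop) continuous_id continuous_const
    fun y hy => by simp [show y = 0 from hy]

lemma fourier_twoSidedExp {a b : ℝ} (ha : 0 < a) (hb : 0 < b) :
    𝓕 (fun y : ℝ => (twoSidedExp a b y : ℂ)) = fun w : ℝ =>
      (a - 2 * Real.pi * w * Complex.I : ℂ)⁻¹ - ((-b : ℝ) - 2 * Real.pi * w * Complex.I : ℂ)⁻¹ := by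
  ext w
  have hb' := neg_lt_zero.2 hb
  rw [sub_eq_add_neg, ← fourier_indicator_exp_Iic ha, ← fourier_indicator_exp_Ioi hb']
  simp only [Real.fourier_eq, twoSidedExp, Complex.ofReal_add, smul_add]
  exact integral_add
    ((Real.fourierIntegral_convergent_iff w).2 (integrable_indicator_exp_Iic ha).ofReal)
    ((Real.fourierIntegral_convergent_iff w).2 (integrable_indicator_exp_Ioi hb').ofReal)

lemma fourier_oneSidedExpSub {a b : ℝ} (ha : 0 < a) (hb : 0 < b) :
    𝓕 (fun y : ℝ => (oneSidedExpSub a b y : ℂ)) = fun w : ℝ =>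
      (a - 2 * Real.pi * w * Complex.I : ℂ)⁻¹ - (b - 2 * Real.pi * w * Complex.I : ℂ)⁻¹ := by
  ext w
  rw [← fourier_indicator_exp_Iic ha, ← fourier_indicator_exp_Iic hb]
  simp only [Real.fourier_eq, oneSidedExpSub, Complex.ofReal_sub, smul_sub]
  exact integral_sub
    ((Real.fourierIntegral_convergent_iff w).2 (integrable_indicator_exp_Iic ha).ofReal)
    ((Real.fourierIntegral_convergent_iff w).2 (integrable_indicator_exp_Iic hb).ofReal)

/-! ### Fourier inversion for sums -/

lemma integrable_comp_sum_mul_prod {w X h : ℝ → ℝ} (hw : Integrable w) (hX : Continuous X)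
    (hh : Measurable h) {C : ℝ} (hC : ∀ y, |h y| ≤ C) (d : ℕ) :
    Integrable fun x : Fin d → ℝ => h (∑ i, X (x i)) * ∏ i, w (x i) := by
  have hS : Continuous fun x : Fin d → ℝ => ∑ i, X (x i) := by fun_prop
  exact (Integrable.fintype_prod (fun _ => hw)).bdd_mul (c := C)
    (hh.comp hS.measurable).aestronglyMeasurable (ae_of_all _ fun x => hC _)

/-- Fourier inversion expresses a weighted integral of a function of `∑ i, X (x i)` through the
powers of a one-dimensional integral. -/
lemma integral_comp_sum_mul_prod {w X h : ℝ → ℝ} (hw : Integrable w) (hX : Continuous X)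
    (hh : Continuous h) (hhi : Integrable h) (hF : Integrable (𝓕 fun y => (h y : ℂ))) (d : ℕ) :
    ((∫ x : Fin d → ℝ, h (∑ i, X (x i)) * ∏ i, w (x i) : ℝ) : ℂ) =
      ∫ t : ℝ, 𝓕 (fun y => (h y : ℂ)) t *
        (∫ y, Complex.exp ((2 * Real.pi * t : ℝ) * X y * Complex.I) * w y) ^ d := by
  set F := 𝓕 fun y => (h y : ℂ)
  have hS : Continuous fun x : Fin d → ℝ => ∑ i, X (x i) := by fun_prop
  have hinv : ∀ s : ℝ, (h s : ℂ) =
      ∫ t : ℝ, Complex.exp ((2 * Real.pi * t : ℝ) * s * Complex.I) * F t := fun s => by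
    have h1 := congrFun ((Complex.continuous_ofReal.comp hh).fourierInv_fourier_eq hhi.ofReal hF) s
    simp only [Function.comp] at h1
    rw [← h1, Real.fourierInv_eq']
    congr 1 with t
    rw [smul_eq_mul]
    congr 2
    simp only [RCLike.inner_apply, conj_trivial]
    push_cast
    ring
  have hprod : Integrable fun x : Fin d → ℝ => ∏ i, (w (x i) : ℂ) :=
    Integrable.fintype_prod (fun _ => hw.ofReal)
  have hjoint : Integrable (Function.uncurry fun (x : Fin d → ℝ) (t : ℝ) =>
      Complex.exp ((2 * Real.pi * t : ℝ) * (∑ i, X (x i) : ℝ) * Complex.I) *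
        ((∏ i, (w (x i) : ℂ)) * F t)) (volume.prod volume) := by
    refine (hprod.mul_prod hF).bdd_mul (c := 1) (Continuous.aestronglyMeasurable ?_)
      (ae_of_all _ fun p => ?_)
    · have h1 : Continuous fun p : (Fin d → ℝ) × ℝ => ∑ i, X (p.1 i) := hS.comp continuous_fst
      fun_prop
    · rw [← Complex.ofReal_mul, Complex.norm_exp_ofReal_mul_I]
  calc ((∫ x : Fin d → ℝ, h (∑ i, X (x i)) * ∏ i, w (x i) : ℝ) : ℂ)
      = ∫ x : Fin d → ℝ, ∫ t : ℝ,
          Complex.exp ((2 * Real.pi * t : ℝ) * (∑ i, X (x i) : ℝ) * Complex.I) *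
            ((∏ i, (w (x i) : ℂ)) * F t) := by
        rw [← integral_complex_ofReal]
        congr 1 with x
        rw [Complex.ofReal_mul, hinv, Complex.ofReal_prod, ← integral_mul_const]
        congr 1 with t
        ring
    _ = ∫ t : ℝ, ∫ x : Fin d → ℝ,
          Complex.exp ((2 * Real.pi * t : ℝ) * (∑ i, X (x i) : ℝ) * Complex.I) *
            ((∏ i, (w (x i) : ℂ)) * F t) := integral_integral_swap hjoint
    _ = _ := by
        congr 1 with t
        have hpow := integral_fintype_prod_volume_eq_pow (ι := Fin d)
          (fun y : ℝ => Complex.exp ((2 * Real.pi * t : ℝ) * X y * Complex.I) * (w y : ℂ))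
        rw [Fintype.card_fin] at hpow
        rw [← hpow, ← integral_const_mul]
        congr 1 with x
        rw [Finset.prod_mul_distrib, ← Complex.exp_sum, ← Finset.sum_mul, ← Finset.mul_sum,
          Complex.ofReal_sum]
        ring

lemma twoSidedExp_fourier_integrable {a b : ℝ} (ha : 0 < a) (hb : 0 < b) :
    Integrable (𝓕 fun y : ℝ => (twoSidedExp a b y : ℂ)) := by
  rw [fourier_twoSidedExp ha hb]
  exact integrable_inv_sub_inv ha.ne' (neg_lt_zero.2 hb).ne

lemma oneSidedExpSub_fourier_integrable {a b : ℝ} (ha : 0 < a) (hb : 0 < b) :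
    Integrable (𝓕 fun y : ℝ => (oneSidedExpSub a b y : ℂ)) := by
  rw [fourier_oneSidedExpSub ha hb]
  exact integrable_inv_sub_inv ha.ne' hb.ne'

lemma abs_indicator_exp_Iic_le {a : ℝ} (ha : 0 < a) (y : ℝ) :
    |(Iic (0 : ℝ)).indicator (fun y => Real.exp (a * y)) y| ≤ 1 := by
  by_cases hy : y ≤ 0
  · simpa [hy] using mul_nonpos_of_nonneg_of_nonpos ha.le hy
  · simp [hy]

lemma abs_oneSidedExpSub_le {a b : ℝ} (ha : 0 < a) (hb : 0 < b) (y : ℝ) :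
    |oneSidedExpSub a b y| ≤ 1 + 1 :=
  (abs_sub _ _).trans (add_le_add (abs_indicator_exp_Iic_le ha y) (abs_indicator_exp_Iic_le hb y))

lemma abs_twoSidedExp_le {a b : ℝ} (ha : 0 < a) (hb : 0 < b) (y : ℝ) :
    |twoSidedExp a b y| ≤ 1 + 1 := by
  refine (abs_add_le _ _).trans (add_le_add (abs_indicator_exp_Iic_le ha y) ?_)
  by_cases hy : 0 < y
  · simpa [hy] using (mul_pos hb hy).le
  · simp [hy]

lemma oneSidedExpSub_le_indicator (a b y : ℝ) :
    oneSidedExpSub a b y ≤ (Iic (0 : ℝ)).indicator (fun y => Real.exp (a * y)) y :=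
  sub_le_self _ (indicator_nonneg (fun _ _ => (Real.exp_pos _).le) _)

lemma indicator_le_twoSidedExp (a b y : ℝ) :
    (Iic (0 : ℝ)).indicator (fun y => Real.exp (a * y)) y ≤ twoSidedExp a b y :=
  le_add_of_nonneg_right (indicator_nonneg (fun _ _ => (Real.exp_pos _).le) _)

/-! ### Local limit theorem and sharp volume asymptotics -/

namespace IsOrliczFunction

variable {M : ℝ → ℝ}

lemma integrable_weight (hM : IsOrliczFunction M) {α : ℝ} (hα : α < 0) (c : ℝ) :
    Integrable fun x => Real.exp (α * M x - c) := by
  simpa only [Real.exp_sub] using (hM.integrable_exp hα).div_const _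

lemma charFun_tilted (hM : IsOrliczFunction M) {α : ℝ} (hα : α < 0) (R t : ℝ) :
    charFun ((volume.tilted (α * M ·)).map fun x => M x - R) t =
      ∫ y, Complex.exp (t * (M y - R : ℝ) * Complex.I) * (Real.exp (α * M y - orliczPhi M α) : ℝ) := by
  have hX : Continuous fun x => M x - R := hM.continuous.sub continuous_const
  rw [charFun_apply_real, integral_map hX.aemeasurable (by fun_prop),
    integral_tilted_mul_eq_cgf _ (hM.integrable_exp hα)]
  congr 1 with y
  rw [Complex.real_smul, mul_comm, orliczPhi_eq_cgf]

/-- Local limit theorem for `∑ i, (M (x i) - R)` under the product of the tilted laws. -/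
theorem tendsto_sqrt_mul_integral (hM : IsOrliczFunction M) {α R : ℝ} (hα : α < 0)
    (hαR : deriv (orliczPhi M) α = R) {h : ℝ → ℝ} (hh : Continuous h) (hhi : Integrable h)
    (hF : Integrable (𝓕 fun y => (h y : ℂ))) (hFc : ContinuousAt (𝓕 fun y => (h y : ℂ)) 0) {L : ℝ}
    (hL : 𝓕 (fun y => (h y : ℂ)) 0 = L) :
    Tendsto (fun d : ℕ => √d * ∫ x : Fin d → ℝ,
      h (∑ i, (M (x i) - R)) * ∏ i, Real.exp (α * M (x i) - orliczPhi M α)) atTop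
      (𝓝 (L / √(2 * Real.pi * deriv (deriv (orliczPhi M)) α))) := by
  have hP := hM.tilted_isProbabilityMeasure hα
  set P := volume.tilted (α * M ·)
  set v := deriv (deriv (orliczPhi M)) α
  have hv : 0 < v := hM.deriv_deriv_orliczPhi_pos hα
  have hX : Continuous fun x => M x - R := hM.continuous.sub continuous_const
  have hLp : MemLp M 2 P := memLp_tilted_mul (hM.mem_interior_integrableExpSet hα) 2
  have hmean : ∫ x, M x ∂P = R := by
    rw [← hαR]
    exact integral_tilted_mul_self (hM.mem_interior_integrableExpSet hα)
  have h0 : ∫ x, (M x - R) ∂P = 0 := by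
    rw [integral_sub (hLp.integrable (by norm_num)) (integrable_const R), hmean]
    simp
  have hvar : Var[fun x => M x - R; P] = v := by
    rw [variance_sub_const hM.continuous.aestronglyMeasurable]
    exact (hM.deriv_deriv_orliczPhi hα).symm
  have hνp : IsProbabilityMeasure (P.map fun x => M x - R) :=
    Measure.isProbabilityMeasure_map hX.aemeasurable
  have hνac : P.map (fun x => M x - R) ≪ volume :=
    ((tilted_absolutelyContinuous volume _).map hX.measurable).trans
      (hM.map_volume_absolutelyContinuous R)
  -- The factor `2π` matches the convention of `𝓕`; it turns the variance `v` into `4π²v`.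
  set χ : ℝ → ℂ := fun t => charFun (P.map fun x => M x - R) (2 * Real.pi * t)
  have hπ : 0 < 2 * Real.pi := Real.two_pi_pos
  have hexp : (fun t : ℝ => χ t - (1 - ((4 * Real.pi ^ 2 * v : ℝ) : ℂ) * t ^ 2 / 2)) =o[𝓝 0]
      fun t : ℝ => t ^ 2 := by
    have h1 := charFun_map_sub_isLittleO (P := P) (hLp.sub (memLp_const R)) h0
    have hlim : Tendsto (fun t : ℝ => 2 * Real.pi * t) (𝓝 0) (𝓝 0) := by
      have : ContinuousAt (fun t : ℝ => 2 * Real.pi * t) 0 := by fun_prop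
      simpa [ContinuousAt] using this
    have h2 := h1.comp_tendsto hlim
    have h3 : ((fun t : ℝ => t ^ 2) ∘ fun t : ℝ => 2 * Real.pi * t) =O[𝓝 0] fun t => t ^ 2 := by
      refine Asymptotics.IsBigO.of_bound ((2 * Real.pi) ^ 2) (Eventually.of_forall fun t => ?_)
      simp [mul_pow]
    refine (h2.trans_isBigO h3).congr_left fun t => ?_
    have hvar' : Var[M - fun _ => R; P] = v := hvar
    simp only [Function.comp, hvar']
    congr 2
    push_cast
    ring
  have hlimC := tendsto_sqrt_mul_integral_mul_pow (χ := χ) (v := 4 * Real.pi ^ 2 * v) (by positivity)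
    (continuous_charFun.comp (continuous_const_mul _)) (fun t => norm_charFun_le_one _) hexp
    (fun ε hε => by
      obtain ⟨ρ, hρ, hb⟩ := exists_norm_charFun_le hνac (mul_pos hπ hε)
      refine ⟨ρ, hρ, fun t ht => hb _ ?_⟩
      rw [abs_mul, abs_of_pos hπ]
      exact mul_le_mul_of_nonneg_left ht hπ.le) hF hFc
  have hconst : L * √(2 * Real.pi / (4 * Real.pi ^ 2 * v)) = L / √(2 * Real.pi * v) := by
    rw [show 2 * Real.pi / (4 * Real.pi ^ 2 * v) = (2 * Real.pi * v)⁻¹ by field_simp; norm_num,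
      Real.sqrt_inv, div_eq_mul_inv]
  rw [hL, ← Complex.ofReal_mul, hconst] at hlimC
  refine tendsto_ofReal_iff.1 (hlimC.congr fun d => ?_)
  have hid := integral_comp_sum_mul_prod (hM.integrable_weight hα (orliczPhi M α)) hX hh hhi hF d
  rw [Complex.ofReal_mul, hid]
  simp only [χ, P, hM.charFun_tilted hα]

/-- On the ball, the weight `e^{-αS}` and the tilted densities cancel the exponential prefactor
exactly. -/
lemma orliczVol_eq (hM : IsOrliczFunction M) (α R : ℝ) (d : ℕ) :
    orliczVol M R d = Real.exp (d * (orliczPhi M α - α * R)) * ∫ x : Fin d → ℝ,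
      (Iic (0 : ℝ)).indicator (fun y => Real.exp (-α * y)) (∑ i, (M (x i) - R)) *
        ∏ i, Real.exp (α * M (x i) - orliczPhi M α) := by
  have hm : MeasurableSet (orliczBall M d (d * R)) := by
    have : Continuous fun x : Fin d → ℝ => ∑ i, M (x i) :=
      continuous_finsetSum _ fun i _ => hM.continuous.comp (continuous_apply i)
    exact (isClosed_le this continuous_const).measurableSet
  rw [orliczVol, ← measureReal_def, ← integral_indicator_one hm, ← integral_const_mul]
  congr 1 with x
  have hsum : ∑ i, (M (x i) - R) = ∑ i, M (x i) - d * R := by simp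
  rw [← Real.exp_sum, hsum]
  have hsum' : ∑ i, (α * M (x i) - orliczPhi M α) = α * ∑ i, M (x i) - d * orliczPhi M α := by
    rw [Finset.sum_sub_distrib, ← Finset.mul_sum]
    simp
  rw [hsum']
  by_cases hx : ∑ i, M (x i) ≤ d * R
  · rw [indicator_of_mem (show x ∈ orliczBall M d (d * R) from hx),
      indicator_of_mem (show _ ∈ Iic (0 : ℝ) from sub_nonpos.2 hx), ← Real.exp_add, ← Real.exp_add,
      Pi.one_apply, eq_comm, Real.exp_eq_one_iff]
    ring
  · rw [indicator_of_notMem (show x ∉ orliczBall M d (d * R) from hx),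
      indicator_of_notMem (show _ ∉ Iic (0 : ℝ) from fun h => hx (sub_nonpos.1 h)), zero_mul,
      mul_zero]

theorem tendsto_sqrt_mul_exp_mul_orliczVol (hM : IsOrliczFunction M) {α R : ℝ} (hα : α < 0)
    (hαR : deriv (orliczPhi M) α = R) :
    Tendsto (fun d : ℕ => √d * (orliczVol M R d / Real.exp (d * (orliczPhi M α - α * R)))) atTop
      (𝓝 ((-α)⁻¹ / √(2 * Real.pi * deriv (deriv (orliczPhi M)) α))) := by
  have ha : 0 < -α := neg_pos.2 hα
  have hX : Continuous fun x => M x - R := hM.continuous.sub continuous_const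
  have hw := hM.integrable_weight hα (orliczPhi M α)
  set κ := √(2 * Real.pi * deriv (deriv (orliczPhi M)) α)
  have hκ : 0 < κ := Real.sqrt_pos.2 (mul_pos Real.two_pi_pos (hM.deriv_deriv_orliczPhi_pos hα))
  have hcont : ∀ c : ℝ, c ≠ 0 →
      ContinuousAt (fun w : ℝ => (c - 2 * Real.pi * w * Complex.I : ℂ)⁻¹) 0 := fun c hc =>
    ContinuousAt.inv₀ (by fun_prop) (by simpa using hc)
  have hupper : ∀ n : ℝ, 0 < n → Tendsto (fun d : ℕ => √d * ∫ x : Fin d → ℝ,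
      twoSidedExp (-α) n (∑ i, (M (x i) - R)) * ∏ i, Real.exp (α * M (x i) - orliczPhi M α)) atTop
      (𝓝 (((-α)⁻¹ + n⁻¹) / κ)) := fun n hn => by
    refine hM.tendsto_sqrt_mul_integral hα hαR (continuous_twoSidedExp _ _)
      (integrable_twoSidedExp ha hn) (twoSidedExp_fourier_integrable ha hn) ?_ ?_
    · rw [fourier_twoSidedExp ha hn]
      exact (hcont _ ha.ne').sub (hcont _ (neg_lt_zero.2 hn).ne)
    · rw [fourier_twoSidedExp ha hn]
      push_cast
      simp only [mul_zero, zero_mul, sub_zero, inv_neg, sub_neg_eq_add]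
  have hlower : ∀ n : ℝ, 0 < n → Tendsto (fun d : ℕ => √d * ∫ x : Fin d → ℝ,
      oneSidedExpSub (-α) n (∑ i, (M (x i) - R)) * ∏ i, Real.exp (α * M (x i) - orliczPhi M α)) atTop
      (𝓝 (((-α)⁻¹ - n⁻¹) / κ)) := fun n hn => by
    refine hM.tendsto_sqrt_mul_integral hα hαR (continuous_oneSidedExpSub _ _)
      (integrable_oneSidedExpSub ha hn) (oneSidedExpSub_fourier_integrable ha hn) ?_ ?_
    · rw [fourier_oneSidedExpSub ha hn]
      exact (hcont _ ha.ne').sub (hcont _ hn.ne')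
    · rw [fourier_oneSidedExpSub ha hn]
      push_cast
      simp only [mul_zero, zero_mul, sub_zero]
  have hmid : ∀ d : ℕ, Integrable fun x : Fin d → ℝ =>
      (Iic (0 : ℝ)).indicator (fun y => Real.exp (-α * y)) (∑ i, (M (x i) - R)) *
        ∏ i, Real.exp (α * M (x i) - orliczPhi M α) := fun d =>
    integrable_comp_sum_mul_prod hw hX
      ((by fun_prop : Measurable fun y => Real.exp (-α * y)).indicator measurableSet_Iic)
      (abs_indicator_exp_Iic_le ha) d
  simp_rw [fun d : ℕ => hM.orliczVol_eq α R d, mul_div_cancel_left₀ _ (Real.exp_ne_zero _)]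
  have hprod : ∀ d : ℕ, ∀ x : Fin d → ℝ, 0 ≤ ∏ i, Real.exp (α * M (x i) - orliczPhi M α) :=
    fun d x => Finset.prod_nonneg fun _ _ => (Real.exp_pos _).le
  -- `s = -1` and `s = 1` give the limits of the lower and upper bounds.
  have hn_lim : ∀ s : ℝ, Tendsto (fun n : ℝ => ((-α)⁻¹ + s * n⁻¹) / κ) atTop (𝓝 ((-α)⁻¹ / κ)) := by
    intro s
    simpa using ((tendsto_inv_atTop_zero.const_mul s).const_add ((-α)⁻¹)).div_const κ
  refine tendsto_order.2 ⟨fun c hc => ?_, fun c hc => ?_⟩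
  · obtain ⟨n, hnc, hn⟩ := (((hn_lim (-1)).eventually (lt_mem_nhds hc)).and
      (eventually_gt_atTop 0)).exists
    rw [neg_one_mul, ← sub_eq_add_neg] at hnc
    filter_upwards [(hlower n hn).eventually (lt_mem_nhds hnc)] with d hd
    refine hd.trans_le (mul_le_mul_of_nonneg_left ?_ (Real.sqrt_nonneg _))
    exact integral_mono (integrable_comp_sum_mul_prod hw hX
      (continuous_oneSidedExpSub _ _).measurable (abs_oneSidedExpSub_le ha hn) d) (hmid d)
      fun x => mul_le_mul_of_nonneg_right (oneSidedExpSub_le_indicator _ _ _) (hprod d x)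
  · obtain ⟨n, hnc, hn⟩ := (((hn_lim 1).eventually (gt_mem_nhds hc)).and
      (eventually_gt_atTop 0)).exists
    rw [one_mul] at hnc
    filter_upwards [(hupper n hn).eventually (gt_mem_nhds hnc)] with d hd
    refine (mul_le_mul_of_nonneg_left ?_ (Real.sqrt_nonneg _)).trans_lt hd
    exact integral_mono (hmid d) (integrable_comp_sum_mul_prod hw hX
      (continuous_twoSidedExp _ _).measurable (abs_twoSidedExp_le ha hn) d)
      fun x => mul_le_mul_of_nonneg_right (indicator_le_twoSidedExp _ _ _) (hprod d x)

end IsOrliczFunction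

/-- Logarithmic asymptotics of a sequence of exact order `d ^ (-1/2) * exp (d * c)`. -/
lemma tendsto_inv_mul_log_of_tendsto_sqrt_mul {V : ℕ → ℝ} {c L : ℝ} (hL : 0 < L)
    (h : Tendsto (fun d : ℕ => √d * (V d / Real.exp (d * c))) atTop (𝓝 L)) :
    (∀ᶠ d in atTop, 0 < V d) ∧
      Tendsto (fun d : ℕ => 1 / (d : ℝ) * Real.log (V d)) atTop (𝓝 c) := by
  have hpos : ∀ᶠ d : ℕ in atTop, 0 < V d := by
    filter_upwards [h.eventually (lt_mem_nhds hL)] with d hd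
    have h1 := pos_of_mul_pos_right hd (Real.sqrt_nonneg _)
    exact (div_pos_iff_of_pos_right (Real.exp_pos _)).1 h1
  refine ⟨hpos, ?_⟩
  have hinv : Tendsto (fun d : ℕ => 1 / (d : ℝ)) atTop (𝓝 0) := tendsto_one_div_atTop_nhds_zero_nat
  have hlog : Tendsto (fun d : ℕ => 1 / (d : ℝ) *
      Real.log (√d * (V d / Real.exp (d * c)))) atTop (𝓝 0) := by
    simpa using hinv.mul (h.log hL.ne')
  have hlogd : Tendsto (fun d : ℕ => Real.log d / d) atTop (𝓝 0) := by
    have := Real.isLittleO_log_id_atTop.tendsto_div_nhds_zero.comp tendsto_natCast_atTop_atTop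
    exact this
  have hsum := (hlog.sub (hlogd.const_mul (1 / 2))).add_const c
  simp only [mul_zero, sub_zero, zero_add] at hsum
  refine hsum.congr' ?_
  filter_upwards [hpos, eventually_gt_atTop 0] with d hd hd0
  have hd1 : (0 : ℝ) < d := Nat.cast_pos.2 hd0
  rw [Real.log_mul (Real.sqrt_pos.2 hd1).ne' (div_pos hd (Real.exp_pos _)).ne',
    Real.log_div hd.ne' (Real.exp_ne_zero _), Real.log_exp, Real.log_sqrt hd1.le]
  field_simp
  ring

end

theorem theoremA (M : ℝ → ℝ) (hM : IsOrliczFunction M) (R : ℝ) (hR : 0 < R) :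
    (∀ α : ℝ, α < 0 → Integrable (fun x : ℝ => Real.exp (α * M x))) ∧
    ContDiffOn ℝ 2 (orliczPhi M) (Set.Iio 0) ∧
    (∃! α : ℝ, α < 0 ∧ deriv (orliczPhi M) α = R) ∧
    ∀ α : ℝ, α < 0 → deriv (orliczPhi M) α = R →
      0 < deriv (deriv (orliczPhi M)) α ∧
      Tendsto (fun d : ℕ => orliczVol M R d ^ (1 / (d : ℝ))) atTop
        (𝓝 (Real.exp (orliczPhi M α - α * R))) ∧
      Tendsto (fun d : ℕ => 1 / (d : ℝ) * Real.log (orliczVol M R d)) atTop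
        (𝓝 (orliczPhi M α - α * R)) ∧
      Tendsto (fun d : ℕ => orliczVol M R d /
          (1 / (|α| * Real.sqrt (2 * Real.pi * d * deriv (deriv (orliczPhi M)) α)) *
            Real.exp (d * (orliczPhi M α - α * R)))) atTop (𝓝 1) := by
  refine ⟨fun α hα => hM.integrable_exp hα, hM.analyticOnNhd_orliczPhi.contDiffOn (uniqueDiffOn_Iio 0), ?_,
    fun α hα hαR => ?_⟩
  · obtain ⟨α, hα, hαR⟩ := hM.exists_deriv_orliczPhi_eq hR
    exact ⟨α, ⟨hα, hαR⟩, fun β hβ =>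
      hM.strictMonoOn_deriv_orliczPhi.injOn hβ.1 hα (hβ.2.trans hαR.symm)⟩
  have hv := hM.deriv_deriv_orliczPhi_pos hα
  set v := deriv (deriv (orliczPhi M)) α
  have hκ : 0 < √(2 * Real.pi * v) := Real.sqrt_pos.2 (mul_pos Real.two_pi_pos hv)
  have hL : 0 < (-α)⁻¹ / √(2 * Real.pi * v) := div_pos (inv_pos.2 (neg_pos.2 hα)) hκ
  have hlim := hM.tendsto_sqrt_mul_exp_mul_orliczVol hα hαR
  obtain ⟨hpos, hlog⟩ := tendsto_inv_mul_log_of_tendsto_sqrt_mul hL hlim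
  refine ⟨hv, ?_, hlog, ?_⟩
  · refine ((Real.continuous_exp.tendsto _).comp hlog).congr' ?_
    filter_upwards [hpos] with d hd
    rw [Real.rpow_def_of_pos hd, Function.comp, mul_comm]
  · have h := hlim.mul_const (|α| * √(2 * Real.pi * v))
    rw [abs_of_neg hα] at h ⊢
    rw [show (-α)⁻¹ / √(2 * Real.pi * v) * (-α * √(2 * Real.pi * v)) = 1 by
      have := hα.ne
      field_simp] at h
    -- At `d = 0` both sides are `0`, since division by zero gives zero.
    refine h.congr fun d => ?_
    rw [show 2 * Real.pi * d * v = d * (2 * Real.pi * v) by ring,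
      Real.sqrt_mul (Nat.cast_nonneg d), one_div_mul_eq_div, div_div_eq_mul_div]
    ring
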